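/- For every $N\in\mathbb N$ let $(Y_{N,k})_{k\in\{1,\dots,N\}}$ be real random variables on a probability space (which may depend on $N$). Suppose that the $N$-th row has a dependency graph of maximum degree $D(N)\in\mathbb Z_{\ge 0}$, that is, a finite multigraph on $\{1,\dots,N\}$ (multiple edges and loops allowed, the degree of a vertex being the number of edges, counted with multiplicity, that it belongs to) such that for all disjoint $V_1,V_2\subset\{1,\dots,N\}$ with no edge having one vertex in $V_1$ and the other in $V_2$, the families $(Y_{N,k})_{k\in V_1}$ and $(Y_{N,k})_{k\in V_2}$ are independent. Fix real numbers $(c_{N,k})_{N\in\mathbb N,\,1\le k\le N}$ and $\delta\in\mathbb R$, and set $$S_N=\sum_{k=1}^N Y_{N,k},\qquad v_N=\sqrt{\operatorname{Var}[S_N]},\qquad W_N=\frac{S_N-\mathbb E[S_N]}{v_N},$$ $$\mathcal A_\delta(N)=\sum_{k=1}^N\mathbb E\big[|Y_{N,k}-c_{N,k}|^\delta\big],\qquad \xi_\delta(N)=\Big(\frac{N}{\mathcal A_\delta(N)}\Big)^{1/\delta}\sqrt{\frac{\operatorname{Var}[S_N]}{N(D(N)+1)}}.$$ Assume that $v_N>0$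 for every $N$ large enough. Consider the following conditions (in (1) and (2), all $Y_{N,k}$ are assumed to be in $L^\delta$). (1) $\delta\in(2,3)$ and $\ \xi_\delta(N)^{-1}\left(\frac{D(N)+1}{N}\right)^{\frac12-\frac1\delta}\to0$ as $N\to\infty$. (2) $\delta\in[3,\infty)$, $\ \xi_\delta(N)^{-1}\left(\frac{D(N)+1}{N}\right)^{\frac12-\frac1\delta}\to0$ and $\ \xi_\delta(N)^{-3}\sqrt{\frac{D(N)+1}{N}}\to0$ as $N\to\infty$. (3) $\sup_{N\in\mathbb N,\,1\le k\le N}\|Y_{N,k}-c_{N,k}\|_\infty<\infty$, $\ \frac{D(N)+1}{v_N}\to0$ and $\ \frac{N(D(N)+1)^2}{v_N^3}\to0$ as $N\to\infty$. If (1), (2) or (3) holds, then $W_N\to\mathcal N(0,1)$ in distribution as $N\to\infty$. Moreover, if (3) holds, or if $\liminf_{N\to\infty}\mathcal A_\delta(N)>0$ and (1) or (2) holds, then the Weak Law of Large Numbers $$\frac{S_N-\mathbb E[S_N]}{\operatorname{Var}[S_N]}\to0\quad\text{in probability as }N\to\infty$$ holds. -/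

import Mathlib

open MeasureTheory ProbabilityTheory Filter Topology

/-- A finite multigraph with vertex set `V`: the edges form a multiset of unordered pairs of
vertices, so multiple edges and loops are allowed. -/
structure Multigraph (V : Type*) where
  edges : Multiset (Sym2 V)

namespace Multigraph

open Classical in
/-- The degree of a vertex: the number of edges (with multiplicity) it belongs to. -/
noncomputable def degree {V : Type*} (G : Multigraph V) (a : V) : ℕ :=
  (G.edges.filter (fun e => a ∈ e)).card

/-- The maximum degree (`0` when there is no vertex). -/
noncomputable def maxDegree {V : Type*} [Fintype V] (G : Multigraph V) : ℕ :=
  Finset.univ.sup G.degree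

/-- `G` is a dependency graph of the family `Y`: whenever `V₁` and `V₂` are disjoint sets of
vertices with no edge between them, `(Y k)_{k ∈ V₁}` and `(Y k)_{k ∈ V₂}` are independent. -/
def IsDependencyGraph {V Ω : Type*} [MeasurableSpace Ω] (G : Multigraph V)
    (Y : V → Ω → ℝ) (P : Measure Ω) : Prop :=
  ∀ V₁ V₂ : Set V, Disjoint V₁ V₂ →
    (∀ a ∈ V₁, ∀ b ∈ V₂, s(a, b) ∉ G.edges) →
    IndepFun (fun (ω : Ω) (k : V₁) => Y k ω) (fun (ω : Ω) (k : V₂) => Y k ω) P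

end Multigraph

/-- The sum `S` of the random variables of one row. -/
def rowSum {V Ω : Type*} [Fintype V] (Y : V → Ω → ℝ) (ω : Ω) : ℝ :=
  ∑ k, Y k ω

/-- The standard deviation `v = √(Var S)`. -/
noncomputable def rowSD {V Ω : Type*} [Fintype V] [MeasurableSpace Ω] (Y : V → Ω → ℝ)
    (P : Measure Ω) : ℝ :=
  Real.sqrt (variance (rowSum Y) P)

/-- The normalized sum `W = (S - E S) / v`. -/
noncomputable def normalizedSum {V Ω : Type*} [Fintype V] [MeasurableSpace Ω] (Y : V → Ω → ℝ)
    (P : Measure Ω) (ω : Ω) : ℝ :=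
  (rowSum Y ω - ∫ ω', rowSum Y ω' ∂P) / rowSD Y P

/-- `A_δ = ∑ₖ E |Y_k - c_k|^δ` (used for `Y_k ∈ L^δ`). -/
noncomputable def momentSum {V Ω : Type*} [Fintype V] [MeasurableSpace Ω] (Y : V → Ω → ℝ)
    (P : Measure Ω) (c : V → ℝ) (δ : ℝ) : ℝ :=
  ∑ k, ∫ ω, |Y k ω - c k| ^ δ ∂P

/-- The renormalized standard deviation
`ξ_δ = (N / A_δ)^(1/δ) * √(Var S / (N (D + 1)))`, with `N` the number of variables. -/
noncomputable def xi {V Ω : Type*} [Fintype V] [MeasurableSpace Ω] (Y : V → Ω → ℝ)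
    (P : Measure Ω) (c : V → ℝ) (D : ℕ) (δ : ℝ) : ℝ :=
  ((Fintype.card V : ℝ) / momentSum Y P c δ) ^ (1 / δ) *
    Real.sqrt (variance (rowSum Y) P / ((Fintype.card V : ℝ) * ((D : ℝ) + 1)))

/-- The `ξ_δ`-condition for `δ ∈ (2,3)`; all variables are in `L^δ`. -/
def XiConditionLow {Ω : ℕ → Type*} [∀ N, MeasurableSpace (Ω N)] (P : ∀ N, Measure (Ω N))
    (Y : ∀ N, Fin N → Ω N → ℝ) (c : ∀ N, Fin N → ℝ) (D : ℕ → ℕ) (δ : ℝ) : Prop :=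
  (2 < δ ∧ δ < 3) ∧
  (∀ N k, MemLp (Y N k) (ENNReal.ofReal δ) (P N)) ∧
  Tendsto (fun N : ℕ => (xi (Y N) (P N) (c N) (D N) δ)⁻¹ *
    (((D N : ℝ) + 1) / (N : ℝ)) ^ (1 / 2 - 1 / δ)) atTop (𝓝 0)

/-- The `ξ_δ`-conditions for `δ ∈ [3,∞)`; all variables are in `L^δ`. -/
def XiConditionHigh {Ω : ℕ → Type*} [∀ N, MeasurableSpace (Ω N)] (P : ∀ N, Measure (Ω N))
    (Y : ∀ N, Fin N → Ω N → ℝ) (c : ∀ N, Fin N → ℝ) (D : ℕ → ℕ) (δ : ℝ) : Prop :=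
  3 ≤ δ ∧
  (∀ N k, MemLp (Y N k) (ENNReal.ofReal δ) (P N)) ∧
  Tendsto (fun N : ℕ => (xi (Y N) (P N) (c N) (D N) δ)⁻¹ *
    (((D N : ℝ) + 1) / (N : ℝ)) ^ (1 / 2 - 1 / δ)) atTop (𝓝 0) ∧
  Tendsto (fun N : ℕ => ((xi (Y N) (P N) (c N) (D N) δ) ^ 3)⁻¹ *
    Real.sqrt (((D N : ℝ) + 1) / (N : ℝ))) atTop (𝓝 0)

/-- The condition for arrays that are uniformly bounded, in `N` and `k`, after centering by
the constants `c N k`. -/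
def BoundedCondition {Ω : ℕ → Type*} [∀ N, MeasurableSpace (Ω N)] (P : ∀ N, Measure (Ω N))
    (Y : ∀ N, Fin N → Ω N → ℝ) (c : ∀ N, Fin N → ℝ) (D : ℕ → ℕ) : Prop :=
  (⨆ N, ⨆ k : Fin N, eLpNorm (fun ω => Y N k ω - c N k) ⊤ (P N)) < ⊤ ∧
  Tendsto (fun N : ℕ => ((D N : ℝ) + 1) / rowSD (Y N) (P N)) atTop (𝓝 0) ∧
  Tendsto (fun N : ℕ => (N : ℝ) * ((D N : ℝ) + 1) ^ 2 / rowSD (Y N) (P N) ^ 3) atTop (𝓝 0)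

/-!
The proof is the method of characteristic functions adapted to dependency graphs (Tikhomirov's form
of Stein's method). Let `X k` be the centred variables of a row divided by the standard deviation
`v` of the sum, `W` their sum, `φ t = E exp (i t W)`, and let `nb k` be the closed neighbourhood
of `k` in the graph. As `X k` is independent of the part `W_k` of the sum outside `nb k`,
expanding `exp (i t W)` around `exp (i t W_k)` to first order gives
`E [X k exp (i t W)] ≈ i t ∑ j ∈ nb k, E [X k X j exp (i t W_k)]`. In the last expectation, `W_k`
may be replaced by the sum outside `nb k ∪ nb j`, which is independent of `X k X j`, and after
factoring by `W` itself, so that it is close to `E [X k X j] φ t`. Since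
`∑ k, ∑ j ∈ nb k, E [X k X j] = Var W = 1`, it follows that `φ' ≈ -t φ`, the equation satisfied by
`exp (-t² / 2)`.

Write `δ = 2 + θ` with `0 < θ ≤ 1`. The bounds `|exp (ix) - 1 - ix| ≤ 2 |x|^(1 + θ)` and
`|exp (ix) - exp (iy)| ≤ 2 |x - y|^θ`, together with
`a b c^θ ≤ a^(2 + θ) + b^(2 + θ) + c^(2 + θ)` and convexity, show that all errors add up to at
most a constant, locally bounded in `t`, times `(D + 1)^(δ - 1) ∑ k, E |X k|^δ`
(`IsLocallyDependent.norm_integral_sum_mul_phase_sub_le`). Integrating the differential inequality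
for `exp (t² / 2) φ t` gives `IsLocallyDependent.norm_integral_phase_sub_exp_le`, and Lévy's
continuity theorem a central limit theorem under the Lyapunov condition
`(D + 1)^(δ - 1) A_δ / v^δ → 0` (`tendstoInDistribution_normalizedSum_of_lyapunov`).

For `δ < 3` the condition on `ξ_δ` is this Lyapunov condition raised to the power `1 / δ`
(`xi_inv_mul_eq`). For `δ ≥ 3` the second condition on `ξ_δ` is the one of order `3` with the third
moments replaced by their upper bound from the power mean inequality (`xi_pow_inv_mul_eq`,
`momentSum_three_le`), and in the bounded case the moments of order `3` are at most a constant.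

The weak law is Chebyshev's inequality once `v → ∞`. In the bounded case this follows from
`(D + 1) / v → 0`, otherwise from `A_δ^(1/δ) (D + 1)^(1 - 1/δ) / v → 0` with `A_δ` bounded below.
-/

/-! ### Power inequalities -/

/-- A crude form of Young's inequality: each factor is at most the largest of the three. -/
lemma mul_mul_rpow_le_add_rpow {a b c θ : ℝ} (ha : 0 ≤ a) (hb : 0 ≤ b) (hc : 0 ≤ c) (hθ : 0 < θ) :
    a * b * c ^ θ ≤ a ^ (2 + θ) + b ^ (2 + θ) + c ^ (2 + θ) := by
  have key : ∀ m : ℝ, 0 ≤ m → a ≤ m → b ≤ m → c ≤ m → a * b * c ^ θ ≤ m ^ (2 + θ) := by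
    intro m hm ham hbm hcm
    calc a * b * c ^ θ ≤ m * m * m ^ θ := by gcongr
      _ = m ^ (2 + θ) := by
        rw [Real.rpow_add' hm (by linarith), Real.rpow_two, sq]
  have h1 := Real.rpow_nonneg ha (2 + θ)
  have h2 := Real.rpow_nonneg hb (2 + θ)
  have h3 := Real.rpow_nonneg hc (2 + θ)
  rcases le_total a b with hab | hab <;> rcases le_total b c with hbc | hbc <;>
    rcases le_total a c with hac | hac
  all_goals first
    | linarith [key a ha le_rfl (by linarith) (by linarith)]
    | linarith [key b hb (by linarith) le_rfl (by linarith)]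
    | linarith [key c hc (by linarith) (by linarith) le_rfl]

lemma mul_rpow_one_add_le_add_rpow {a b θ : ℝ} (ha : 0 ≤ a) (hb : 0 ≤ b) (hθ : 0 < θ) :
    a * b ^ (1 + θ) ≤ a ^ (2 + θ) + b ^ (2 + θ) := by
  rcases le_total a b with h | h
  · calc a * b ^ (1 + θ) ≤ b * b ^ (1 + θ) := by gcongr
      _ = b ^ (2 + θ) := by
        rw [show 2 + θ = 1 + (1 + θ) by ring, Real.rpow_add' hb (by linarith) (y := 1) (z := 1 + θ),
          Real.rpow_one]
      _ ≤ _ := le_add_of_nonneg_left (by positivity)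
  · calc a * b ^ (1 + θ) ≤ a * a ^ (1 + θ) := by gcongr
      _ = a ^ (2 + θ) := by
        rw [show 2 + θ = 1 + (1 + θ) by ring, Real.rpow_add' ha (by linarith) (y := 1) (z := 1 + θ),
          Real.rpow_one]
      _ ≤ _ := le_add_of_nonneg_right (by positivity)

/-- Convexity of the power function, for sums of at most `m` terms. -/
lemma abs_sum_div_rpow_le {ι : Type*} (s : Finset ι) (x : ι → ℝ) {m p : ℝ} (hm : 0 < m)
    (hs : (s.card : ℝ) ≤ m) (hp : 1 ≤ p) :
    (|∑ i ∈ s, x i| / m) ^ p ≤ (∑ i ∈ s, |x i| ^ p) / m := by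
  have h : |∑ i ∈ s, x i| ^ p ≤ m ^ (p - 1) * ∑ i ∈ s, |x i| ^ p :=
    calc |∑ i ∈ s, x i| ^ p ≤ (∑ i ∈ s, |x i|) ^ p := by
          gcongr
          exact Finset.abs_sum_le_sum_abs _ _
      _ ≤ (s.card : ℝ) ^ (p - 1) * ∑ i ∈ s, |x i| ^ p := Real.rpow_sum_le_const_mul_sum_rpow s x hp
      _ ≤ _ := by
          gcongr
  rw [Real.div_rpow (abs_nonneg _) hm.le, div_le_iff₀ (by positivity)]
  refine h.trans (le_of_eq ?_)
  rw [Real.rpow_sub_one hm.ne']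
  ring

/-! ### Increments of the complex exponential -/

/-- The character `x ↦ exp (i x)` of the real line. -/
noncomputable def phase (x : ℝ) : ℂ := Complex.exp (Complex.I * x)

@[simp] lemma norm_phase (x : ℝ) : ‖phase x‖ = 1 := by
  rw [phase, mul_comm, Complex.norm_exp_ofReal_mul_I]

@[simp] lemma phase_zero : phase 0 = 1 := by simp [phase]

lemma phase_add (x y : ℝ) : phase (x + y) = phase x * phase y := by
  simp [phase, mul_add, Complex.exp_add]

@[fun_prop] lemma continuous_phase : Continuous phase := by unfold phase; fun_prop

@[fun_prop] lemma measurable_phase : Measurable phase := continuous_phase.measurable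

/-- The linear bound for small `x` and the trivial one for large `x`, interpolated. -/
lemma norm_phase_sub_one_le (x : ℝ) {θ : ℝ} (h0 : 0 < θ) (h1 : θ ≤ 1) :
    ‖phase x - 1‖ ≤ 2 * |x| ^ θ := by
  rcases le_total |x| 1 with hx | hx
  · have h : ‖phase x - 1‖ ≤ |x| := by
      simpa [phase] using Real.norm_exp_I_mul_ofReal_sub_one_le (x := x)
    have h' : |x| ≤ |x| ^ θ := by
      simpa using Real.rpow_le_rpow_of_exponent_ge_of_imp (abs_nonneg x) hx h1 (by simp [h0.ne'])
    linarith [abs_nonneg x]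
  · have h : ‖phase x - 1‖ ≤ 2 := (norm_sub_le _ _).trans (by simp; norm_num)
    linarith [Real.one_le_rpow hx h0.le]

lemma norm_phase_sub_phase_le (x y : ℝ) {θ : ℝ} (h0 : 0 < θ) (h1 : θ ≤ 1) :
    ‖phase x - phase y‖ ≤ 2 * |x - y| ^ θ := by
  have : phase x - phase y = phase y * (phase (x - y) - 1) := by
    rw [mul_sub, ← phase_add]; simp
  rw [this, norm_mul, norm_phase, one_mul]
  exact norm_phase_sub_one_le _ h0 h1

/-- The quadratic bound for small `x` and the linear one for large `x`, interpolated. -/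
lemma norm_phase_sub_one_sub_le (x : ℝ) {θ : ℝ} (h0 : 0 < θ) (h1 : θ ≤ 1) :
    ‖phase x - 1 - Complex.I * x‖ ≤ 2 * |x| ^ (1 + θ) := by
  have hn : ‖Complex.I * (x : ℂ)‖ = |x| := by simp
  rcases le_total |x| 1 with hx | hx
  · have h : ‖phase x - 1 - Complex.I * x‖ ≤ |x| ^ (2 : ℝ) := by
      have := Complex.norm_exp_sub_one_sub_id_le (x := Complex.I * x) (by rw [hn]; exact hx)
      rw [hn] at this
      simpa [phase] using this
    have h' : |x| ^ (2 : ℝ) ≤ |x| ^ (1 + θ) :=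
      Real.rpow_le_rpow_of_exponent_ge_of_imp (abs_nonneg x) hx (by linarith) (by intro _ h; linarith)
    linarith [Real.rpow_nonneg (abs_nonneg x) (1 + θ)]
  · have h : ‖phase x - 1 - Complex.I * x‖ ≤ 2 * |x| := by
      -- for large `x` both `exp (ix) - 1` and `ix` are at most `|x|`
      refine (norm_sub_le _ _).trans ?_
      rw [hn]
      have := Real.norm_exp_I_mul_ofReal_sub_one_le (x := x)
      rw [Real.norm_eq_abs] at this
      unfold phase
      linarith
    have h' : |x| ≤ |x| ^ (1 + θ) := by
      simpa using Real.rpow_le_rpow_of_exponent_le hx (show (1 : ℝ) ≤ 1 + θ by linarith)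
    linarith

/-! ### Sums of locally dependent variables -/

/-- A local dependence structure for a centred family `X` of order `2 + θ`: every index `k` has a
closed neighbourhood `nb k` such that, for every set `T` of indices, the variables indexed by `T`
are independent of those indexed outside the union of the neighbourhoods of `T`. The number `d`
bounds the size of all neighbourhoods. -/
structure IsLocallyDependent {V Ω : Type*} [Fintype V] [DecidableEq V] [MeasurableSpace Ω]
    (P : Measure Ω) (X : V → Ω → ℝ) (nb : V → Finset V) (θ d : ℝ) : Prop where
  measurable : ∀ k, Measurable (X k)
  memLp : ∀ k, MemLp (X k) (ENNReal.ofReal (2 + θ)) P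
  integral_eq_zero : ∀ k, ∫ ω, X k ω ∂P = 0
  self_mem : ∀ k, k ∈ nb k
  symm : ∀ {j k}, j ∈ nb k → k ∈ nb j
  card_le : ∀ k, ((nb k).card : ℝ) ≤ d
  indep : ∀ T : Finset V, IndepFun (fun (ω : Ω) (k : (T : Set V)) => X k ω)
    (fun (ω : Ω) (k : (((T.biUnion nb)ᶜ : Finset V) : Set V)) => X k ω) P

namespace IsLocallyDependent

variable {V Ω : Type*} [Fintype V] [DecidableEq V] [MeasurableSpace Ω]
  {P : Measure Ω} [IsProbabilityMeasure P] {X : V → Ω → ℝ} {nb : V → Finset V} {θ d : ℝ}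

omit [IsProbabilityMeasure P] in
lemma indepFun_sum (h : IsLocallyDependent P X nb θ d) (k : V) :
    IndepFun (X k) (fun ω => ∑ i ∈ (nb k)ᶜ, X i ω) P := by
  have e : (fun ω => ∑ i ∈ (nb k)ᶜ, X i ω) = fun ω =>
      ∑ i : (((({k} : Finset V).biUnion nb)ᶜ : Finset V) : Set V), X i ω := by
    funext ω
    rw [← Finset.singleton_biUnion (a := k) (t := nb)]
    exact (Finset.sum_coe_sort (({k} : Finset V).biUnion nb)ᶜ (fun i => X i ω)).symm
  rw [e]
  exact (h.indep {k}).comp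
    (φ := fun x : (({k} : Finset V) : Set V) → ℝ => x ⟨k, by simp⟩)
    (ψ := fun x : (((({k} : Finset V).biUnion nb)ᶜ : Finset V) : Set V) → ℝ => ∑ i, x i)
    (by fun_prop) (by fun_prop)

omit [IsProbabilityMeasure P] in
lemma indepFun_mul_sum (h : IsLocallyDependent P X nb θ d) (k j : V) :
    IndepFun (fun ω => X k ω * X j ω) (fun ω => ∑ i ∈ (nb k ∪ nb j)ᶜ, X i ω) P := by
  have h1 := h.indep {k, j}
  have h2 := h1.comp
    (φ := fun x : (({k, j} : Finset V) : Set V) → ℝ => x ⟨k, by simp⟩ * x ⟨j, by simp⟩)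
    (ψ := fun x : (((({k, j} : Finset V).biUnion nb)ᶜ : Finset V) : Set V) → ℝ => ∑ i, x i)
    (by fun_prop) (by fun_prop)
  convert! h2 using 1
  funext ω
  have e : nb k ∪ nb j = ({k, j} : Finset V).biUnion nb := by simp [Finset.biUnion_insert]
  rw [e]
  exact (Finset.sum_coe_sort (({k, j} : Finset V).biUnion nb)ᶜ (fun i => X i ω)).symm

omit [IsProbabilityMeasure P] in
lemma indepFun (h : IsLocallyDependent P X nb θ d) {k j : V} (hj : j ∉ nb k) :
    IndepFun (X k) (X j) P :=
  (h.indep {k}).comp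
    (φ := fun x : (({k} : Finset V) : Set V) → ℝ => x ⟨k, by simp⟩)
    (ψ := fun x : (((({k} : Finset V).biUnion nb)ᶜ : Finset V) : Set V) → ℝ =>
      x ⟨j, by simpa using hj⟩)
    (by fun_prop) (by fun_prop)

lemma memLp_two (h : IsLocallyDependent P X nb θ d) (hθ : 0 < θ) (k : V) : MemLp (X k) 2 P :=
  (h.memLp k).mono_exponent (by
    rw [← ENNReal.ofReal_ofNat]; exact ENNReal.ofReal_le_ofReal (by linarith))

lemma integrable (h : IsLocallyDependent P X nb θ d) (hθ : 0 < θ) (k : V) : Integrable (X k) P :=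
  (h.memLp_two hθ k).integrable one_le_two

lemma integrable_mul (h : IsLocallyDependent P X nb θ d) (hθ : 0 < θ) (k j : V) :
    Integrable (fun ω => X k ω * X j ω) P :=
  (h.memLp_two hθ k).integrable_mul (h.memLp_two hθ j)

omit [IsProbabilityMeasure P] in
lemma integrable_rpow (h : IsLocallyDependent P X nb θ d) (hθ : 0 < θ) (k : V) :
    Integrable (fun ω => |X k ω| ^ (2 + θ)) P := by
  have := (h.memLp k).integrable_norm_rpow (by simp; linarith) (by simp)
  rwa [ENNReal.toReal_ofReal (by linarith)] at this

omit [IsProbabilityMeasure P] in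
lemma integrable_mul_phase {f g : Ω → ℝ} (hf : Integrable f P) (hg : Measurable g) :
    Integrable (fun ω => (f ω : ℂ) * phase (g ω)) P :=
  hf.ofReal.mul_bdd (c := 1) (by fun_prop) (by simp)

/-- The absolute moment of order `2 + θ` of the variable with index `k`. -/
noncomputable def absMoment (P : Measure Ω) (X : V → Ω → ℝ) (θ : ℝ) (k : V) : ℝ :=
  ∫ ω, |X k ω| ^ (2 + θ) ∂P

omit [Fintype V] [DecidableEq V] [IsProbabilityMeasure P] in
lemma absMoment_nonneg (k : V) : 0 ≤ absMoment P X θ k :=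
  integral_nonneg fun _ => by positivity

omit [IsProbabilityMeasure P] in
lemma sum_sum_nb_le (h : IsLocallyDependent P X nb θ d) {f : V → ℝ} (hf : ∀ k, 0 ≤ f k) :
    ∑ k, ∑ _j ∈ nb k, f k ≤ d * ∑ k, f k := by
  rw [Finset.mul_sum]
  refine Finset.sum_le_sum fun k _ => ?_
  rw [Finset.sum_const, nsmul_eq_mul]
  exact mul_le_mul_of_nonneg_right (h.card_le k) (hf k)

omit [IsProbabilityMeasure P] in
/-- Double counting, by the symmetry of the neighbourhood relation. -/
lemma sum_sum_nb_comm (h : IsLocallyDependent P X nb θ d) (f : V → ℝ) :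
    ∑ k, ∑ j ∈ nb k, f j = ∑ k, ∑ _j ∈ nb k, f k := by
  refine Finset.sum_comm' fun k j => ?_
  simpa using ⟨fun hj => h.symm hj, fun hk => h.symm hk⟩

/-- The remainder when the phase of the full sum is replaced, in the product with `X k`, by its
first-order expansion around the part of the sum that is independent of `X k`. -/
lemma norm_integral_mul_phase_sub_le (h : IsLocallyDependent P X nb θ d) (h0 : 0 < θ) (h1 : θ ≤ 1)
    {m : ℝ} (hm : 0 < m) (hdm : d ≤ m) (t : ℝ) (k : V) :
    ‖∫ ω, (X k ω : ℂ) * phase (t * ∑ i, X i ω) ∂P -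
      Complex.I * t * ∑ j ∈ nb k,
        ∫ ω, ((X k ω * X j ω : ℝ) : ℂ) * phase (t * ∑ i ∈ (nb k)ᶜ, X i ω) ∂P‖ ≤
      2 * |t| ^ (1 + θ) * m ^ (1 + θ) *
        (absMoment P X θ k + (∑ j ∈ nb k, absMoment P X θ j) / m) := by
  have hX := h.measurable
  have hint0 : Integrable (fun ω => (X k ω : ℂ) * phase (t * ∑ i, X i ω)) P :=
    integrable_mul_phase (h.integrable h0 k) (by fun_prop)
  have hint1 : Integrable (fun ω => (X k ω : ℂ) * phase (t * ∑ i ∈ (nb k)ᶜ, X i ω)) P :=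
    integrable_mul_phase (h.integrable h0 k) (by fun_prop)
  have hint2 : ∀ j, Integrable
      (fun ω => ((X k ω * X j ω : ℝ) : ℂ) * phase (t * ∑ i ∈ (nb k)ᶜ, X i ω)) P :=
    fun j => integrable_mul_phase (h.integrable_mul h0 k j) (by fun_prop)
  have hint3 : Integrable (fun ω => (X k ω : ℂ) * phase (t * ∑ i, X i ω) - Complex.I * t *
      ∑ j ∈ nb k, ((X k ω * X j ω : ℝ) : ℂ) * phase (t * ∑ i ∈ (nb k)ᶜ, X i ω)) P :=
    hint0.sub ((integrable_finsetSum _ fun j _ => hint2 j).const_mul _)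
  -- the zeroth-order term vanishes by independence and centring
  have hzero : ∫ ω, (X k ω : ℂ) * phase (t * ∑ i ∈ (nb k)ᶜ, X i ω) ∂P = 0 := by
    rw [(h.indepFun_sum k).integral_fun_comp_mul_comp (f := fun x : ℝ => (x : ℂ))
      (g := fun x => phase (t * x)) (by fun_prop) (by fun_prop) (by fun_prop)
      (by apply Measurable.aestronglyMeasurable; fun_prop), integral_complex_ofReal,
      h.integral_eq_zero k]
    simp
  rw [← integral_finsetSum _ fun j _ => hint2 j, ← integral_const_mul, ← integral_sub hint0
    ((integrable_finsetSum _ fun j _ => hint2 j).const_mul _), ← sub_zero (∫ _, _ ∂P), ← hzero,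
    ← integral_sub hint3 hint1]
  have hmaj : Integrable (fun ω => 2 * |t| ^ (1 + θ) * m ^ (1 + θ) *
      (|X k ω| ^ (2 + θ) + (∑ j ∈ nb k, |X j ω| ^ (2 + θ)) / m)) P :=
    ((h.integrable_rpow h0 k).add
      ((integrable_finsetSum _ fun j _ => h.integrable_rpow h0 j).div_const m)).const_mul _
  refine (norm_integral_le_of_norm_le hmaj (ae_of_all _ fun ω => ?_)).trans (le_of_eq ?_)
  · set Z := ∑ j ∈ nb k, X j ω with hZ
    set W := ∑ j ∈ (nb k)ᶜ, X j ω with hW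
    have hsum : ∑ i, X i ω = W + Z := by
      rw [add_comm, hZ, hW, Finset.sum_add_sum_compl]
    have hfac : (X k ω : ℂ) * phase (t * ∑ i, X i ω) -
        Complex.I * t * ∑ j ∈ nb k, ((X k ω * X j ω : ℝ) : ℂ) * phase (t * W) -
        (X k ω : ℂ) * phase (t * W) =
        (X k ω : ℂ) * phase (t * W) * (phase (t * Z) - 1 - Complex.I * ((t * Z : ℝ) : ℂ)) := by
      rw [← Finset.sum_mul, hsum, mul_add, phase_add]
      push_cast
      rw [← Finset.mul_sum, hZ]
      push_cast
      ring
    rw [hfac, norm_mul, norm_mul, norm_phase, mul_one, Complex.norm_real, Real.norm_eq_abs]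
    calc |X k ω| * ‖phase (t * Z) - 1 - Complex.I * ((t * Z : ℝ) : ℂ)‖
        ≤ |X k ω| * (2 * |t * Z| ^ (1 + θ)) := by
          gcongr
          exact norm_phase_sub_one_sub_le _ h0 h1
      _ = 2 * |t| ^ (1 + θ) * m ^ (1 + θ) * (|X k ω| * (|Z| / m) ^ (1 + θ)) := by
          rw [abs_mul, Real.mul_rpow (abs_nonneg _) (abs_nonneg _),
            Real.div_rpow (abs_nonneg _) hm.le]
          field_simp
      _ ≤ 2 * |t| ^ (1 + θ) * m ^ (1 + θ) * (|X k ω| ^ (2 + θ) + (|Z| / m) ^ (2 + θ)) := by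
          gcongr
          exact mul_rpow_one_add_le_add_rpow (abs_nonneg _) (by positivity) h0
      _ ≤ _ := by
          gcongr
          exact abs_sum_div_rpow_le _ _ hm ((h.card_le k).trans hdm) (by linarith)
  · rw [integral_const_mul, integral_add (h.integrable_rpow h0 k)
      ((integrable_finsetSum _ fun j _ => h.integrable_rpow h0 j).div_const m),
      integral_div, integral_finsetSum _ fun j _ => h.integrable_rpow h0 j]
    rfl

omit [IsProbabilityMeasure P] in
/-- A product `X k * X j` interacts with the increment of the phase over a set `S` of indices
near `k` and `j` only through absolute moments of order `2 + θ`. The sample points of the two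
factors need not agree, which covers both a joint expectation and a product of expectations. -/
lemma abs_mul_mul_norm_phase_sub_le (h : IsLocallyDependent P X nb θ d) (h0 : 0 < θ) (h1 : θ ≤ 1)
    (hd : 0 < d) (t : ℝ) (k j : V) {S : Finset V} (hS : S ⊆ nb k ∪ nb j) {x y : ℝ} (ω ω' : Ω)
    (hxy : x - y = ∑ i ∈ S, X i ω') :
    |X k ω * X j ω| * ‖phase (t * x) - phase (t * y)‖ ≤
      2 * |t| ^ θ * (2 * d) ^ θ * (|X k ω| ^ (2 + θ) + |X j ω| ^ (2 + θ) +
        (∑ i ∈ nb k, |X i ω'| ^ (2 + θ) + ∑ i ∈ nb j, |X i ω'| ^ (2 + θ)) / (2 * d)) := by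
  have hm : 0 < 2 * d := by positivity
  have hcard : (S.card : ℝ) ≤ 2 * d := by
    have : S.card ≤ (nb k).card + (nb j).card :=
      (Finset.card_le_card hS).trans (Finset.card_union_le _ _)
    have : (S.card : ℝ) ≤ (nb k).card + (nb j).card := by exact_mod_cast this
    linarith [h.card_le k, h.card_le j]
  have hsum : ∑ i ∈ S, |X i ω'| ^ (2 + θ) ≤
      ∑ i ∈ nb k, |X i ω'| ^ (2 + θ) + ∑ i ∈ nb j, |X i ω'| ^ (2 + θ) := by
    rw [← Finset.sum_union_inter]
    refine (Finset.sum_le_sum_of_subset_of_nonneg hS fun _ _ _ => by positivity).trans ?_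
    exact le_add_of_nonneg_right (Finset.sum_nonneg fun _ _ => by positivity)
  calc |X k ω * X j ω| * ‖phase (t * x) - phase (t * y)‖
      ≤ |X k ω * X j ω| * (2 * |t * x - t * y| ^ θ) := by
        gcongr
        exact norm_phase_sub_phase_le _ _ h0 h1
    _ = 2 * |t| ^ θ * (2 * d) ^ θ *
          (|X k ω| * |X j ω| * (|∑ i ∈ S, X i ω'| / (2 * d)) ^ θ) := by
        rw [← mul_sub, hxy, abs_mul, abs_mul, Real.mul_rpow (abs_nonneg _) (abs_nonneg _),
          Real.div_rpow (abs_nonneg _) hm.le]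
        field_simp
    _ ≤ 2 * |t| ^ θ * (2 * d) ^ θ * (|X k ω| ^ (2 + θ) + |X j ω| ^ (2 + θ) +
          (|∑ i ∈ S, X i ω'| / (2 * d)) ^ (2 + θ)) := by
        gcongr
        exact mul_mul_rpow_le_add_rpow (abs_nonneg _) (abs_nonneg _) (by positivity) h0
    _ ≤ _ := by
        gcongr
        refine (abs_sum_div_rpow_le _ _ hm hcard (by linarith)).trans ?_
        gcongr

/-- Up to moments of order `2 + θ`, a product `X k * X j` is uncorrelated with the phase of the
sum outside the neighbourhood of `k`, and this phase may be replaced by that of the full sum. -/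
lemma norm_integral_mul_mul_phase_sub_le (h : IsLocallyDependent P X nb θ d) (h0 : 0 < θ)
    (h1 : θ ≤ 1) (hd : 0 < d) (t : ℝ) (k j : V) :
    ‖∫ ω, ((X k ω * X j ω : ℝ) : ℂ) * phase (t * ∑ i ∈ (nb k)ᶜ, X i ω) ∂P -
      ((∫ ω, X k ω * X j ω ∂P : ℝ) : ℂ) * ∫ ω, phase (t * ∑ i, X i ω) ∂P‖ ≤
      4 * |t| ^ θ * (2 * d) ^ θ * (absMoment P X θ k + absMoment P X θ j +
        (∑ i ∈ nb k, absMoment P X θ i + ∑ i ∈ nb j, absMoment P X θ i) / (2 * d)) := by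
  have hX := h.measurable
  set C := 2 * |t| ^ θ * (2 * d) ^ θ with hC
  set B := absMoment P X θ k + absMoment P X θ j +
        (∑ i ∈ nb k, absMoment P X θ i + ∑ i ∈ nb j, absMoment P X θ i) / (2 * d) with hB
  have hI : ∀ i, Integrable (fun ω => |X i ω| ^ (2 + θ)) P := h.integrable_rpow h0
  have hIs : ∀ i, Integrable (fun ω => ∑ l ∈ nb i, |X l ω| ^ (2 + θ)) P :=
    fun i => integrable_finsetSum _ fun l _ => hI l
  have hIn : Integrable (fun ω =>
      (∑ i ∈ nb k, |X i ω| ^ (2 + θ) + ∑ i ∈ nb j, |X i ω| ^ (2 + θ)) / (2 * d)) P :=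
    ((hIs k).add (hIs j)).div_const _
  have hIkj : Integrable (fun ω => |X k ω| ^ (2 + θ) + |X j ω| ^ (2 + θ)) P := (hI k).add (hI j)
  have hvn : ∫ ω, (∑ i ∈ nb k, |X i ω| ^ (2 + θ) + ∑ i ∈ nb j, |X i ω| ^ (2 + θ)) / (2 * d) ∂P =
      (∑ i ∈ nb k, absMoment P X θ i + ∑ i ∈ nb j, absMoment P X θ i) / (2 * d) := by
    rw [integral_div, integral_add (hIs k) (hIs j), integral_finsetSum _ fun l _ => hI l,
      integral_finsetSum _ fun l _ => hI l]
    rfl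
  have hvkj : ∫ ω, |X k ω| ^ (2 + θ) + |X j ω| ^ (2 + θ) ∂P =
      absMoment P X θ k + absMoment P X θ j := integral_add (hI k) (hI j)
  have hph : ∀ S : Finset V, Integrable (fun ω => phase (t * ∑ i ∈ S, X i ω)) P := fun S =>
    Integrable.of_bound (C := 1) (by apply Measurable.aestronglyMeasurable; fun_prop) (by simp)
  have hint : ∀ S : Finset V, Integrable
      (fun ω => ((X k ω * X j ω : ℝ) : ℂ) * phase (t * ∑ i ∈ S, X i ω)) P :=
    fun S => integrable_mul_phase (h.integrable_mul h0 k j) (by fun_prop)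
  -- enlarging the removed set from `nb k` to `nb k ∪ nb j`
  have hA : ‖∫ ω, ((X k ω * X j ω : ℝ) : ℂ) * phase (t * ∑ i ∈ (nb k)ᶜ, X i ω) ∂P -
      ∫ ω, ((X k ω * X j ω : ℝ) : ℂ) * phase (t * ∑ i ∈ (nb k ∪ nb j)ᶜ, X i ω) ∂P‖ ≤ C * B := by
    rw [← integral_sub (hint _) (hint _)]
    refine (norm_integral_le_of_norm_le ((hIkj.add hIn).const_mul C)
      (ae_of_all _ fun ω => ?_)).trans (le_of_eq ?_)
    · rw [← mul_sub, norm_mul, Complex.norm_real, Real.norm_eq_abs]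
      refine h.abs_mul_mul_norm_phase_sub_le h0 h1 hd t k j
        (S := (nb k ∪ nb j) \ nb k) Finset.sdiff_subset ω ω ?_
      rw [sub_eq_iff_eq_add, ← Finset.sum_union]
      · congr 1
        ext i
        simp
        tauto
      · rw [Finset.disjoint_left]
        intro i hi hi'
        simp at hi hi'
        tauto
    · simp only [Pi.add_apply]
      rw [integral_const_mul, integral_add hIkj hIn, hvn, hvkj]
  -- putting the removed terms back, after factoring the expectation
  have hD : ‖((∫ ω, X k ω * X j ω ∂P : ℝ) : ℂ) *
        (∫ ω, phase (t * ∑ i ∈ (nb k ∪ nb j)ᶜ, X i ω) ∂P - ∫ ω, phase (t * ∑ i, X i ω) ∂P)‖ ≤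
      C * B := by
    rw [← integral_sub (hph _) (hph _), norm_mul, Complex.norm_real, Real.norm_eq_abs]
    have hpt : ∀ ω', |∫ ω, X k ω * X j ω ∂P| *
        ‖phase (t * ∑ i ∈ (nb k ∪ nb j)ᶜ, X i ω') - phase (t * ∑ i, X i ω')‖ ≤
        C * (absMoment P X θ k + absMoment P X θ j +
          (∑ i ∈ nb k, |X i ω'| ^ (2 + θ) + ∑ i ∈ nb j, |X i ω'| ^ (2 + θ)) / (2 * d)) := by
      intro ω'
      calc |∫ ω, X k ω * X j ω ∂P| *
            ‖phase (t * ∑ i ∈ (nb k ∪ nb j)ᶜ, X i ω') - phase (t * ∑ i, X i ω')‖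
          ≤ (∫ ω, |X k ω * X j ω| ∂P) *
            ‖phase (t * ∑ i ∈ (nb k ∪ nb j)ᶜ, X i ω') - phase (t * ∑ i, X i ω')‖ := by
            gcongr
            exact abs_integral_le_integral_abs
        _ = ∫ ω, |X k ω * X j ω| *
            ‖phase (t * ∑ i ∈ (nb k ∪ nb j)ᶜ, X i ω') - phase (t * ∑ i, X i ω')‖ ∂P :=
            (integral_mul_const _ _).symm
        _ ≤ ∫ ω, C * (|X k ω| ^ (2 + θ) + |X j ω| ^ (2 + θ) +
          (∑ i ∈ nb k, |X i ω'| ^ (2 + θ) + ∑ i ∈ nb j, |X i ω'| ^ (2 + θ)) / (2 * d)) ∂P := by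
            refine integral_mono ((h.integrable_mul h0 k j).abs.mul_const _)
              ((hIkj.add (integrable_const _)).const_mul C) fun ω => ?_
            dsimp only
            rw [norm_sub_rev]
            refine h.abs_mul_mul_norm_phase_sub_le h0 h1 hd t k j
              (S := nb k ∪ nb j) subset_rfl ω ω' ?_
            rw [sub_eq_iff_eq_add, Finset.sum_add_sum_compl]
        _ = _ := by
            rw [integral_const_mul, integral_add hIkj (integrable_const _), hvkj]
            simp
    calc |∫ ω, X k ω * X j ω ∂P| *
          ‖∫ ω, (phase (t * ∑ i ∈ (nb k ∪ nb j)ᶜ, X i ω) - phase (t * ∑ i, X i ω)) ∂P‖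
        ≤ |∫ ω, X k ω * X j ω ∂P| *
          ∫ ω, ‖phase (t * ∑ i ∈ (nb k ∪ nb j)ᶜ, X i ω) - phase (t * ∑ i, X i ω)‖ ∂P := by
          gcongr
          exact norm_integral_le_integral_norm _
      _ = ∫ ω, |∫ ω, X k ω * X j ω ∂P| *
          ‖phase (t * ∑ i ∈ (nb k ∪ nb j)ᶜ, X i ω) - phase (t * ∑ i, X i ω)‖ ∂P :=
          (integral_const_mul _ _).symm
      _ ≤ ∫ ω, C * (absMoment P X θ k + absMoment P X θ j +
          (∑ i ∈ nb k, |X i ω| ^ (2 + θ) + ∑ i ∈ nb j, |X i ω| ^ (2 + θ)) / (2 * d)) ∂P :=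
          integral_mono ((((hph _).sub (hph _)).norm).const_mul _)
            (((integrable_const _).add hIn).const_mul C) hpt
      _ = C * B := by
          rw [integral_const_mul, integral_add (integrable_const _) hIn, hvn]
          simp [hB]
  have hfac : ∫ ω, ((X k ω * X j ω : ℝ) : ℂ) * phase (t * ∑ i ∈ (nb k ∪ nb j)ᶜ, X i ω) ∂P =
      ((∫ ω, X k ω * X j ω ∂P : ℝ) : ℂ) *
        ∫ ω, phase (t * ∑ i ∈ (nb k ∪ nb j)ᶜ, X i ω) ∂P := by
    rw [← integral_complex_ofReal]
    exact (h.indepFun_mul_sum k j).integral_fun_comp_mul_comp (f := fun x : ℝ => (x : ℂ))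
      (g := fun x => phase (t * x)) (by fun_prop) (by fun_prop) (by fun_prop)
      (by apply Measurable.aestronglyMeasurable; fun_prop)
  rw [hfac] at hA
  rw [mul_sub] at hD
  calc _ ≤ C * B + C * B := (norm_sub_le_norm_sub_add_norm_sub _ _ _).trans (add_le_add hA hD)
    _ = _ := by rw [hC]; ring

/-- The characteristic function `φ` of a normalized sum of locally dependent variables nearly
satisfies the equation `φ' = -t φ` of the Gaussian one: the left-hand side is `‖φ' + t φ‖`. -/
lemma norm_integral_sum_mul_phase_sub_le (h : IsLocallyDependent P X nb θ d) (h0 : 0 < θ)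
    (h1 : θ ≤ 1) (hd : 0 < d) (hvar : ∫ ω, (∑ k, X k ω) ^ 2 ∂P = 1) (t : ℝ) :
    ‖∫ ω, ((∑ k, X k ω : ℝ) : ℂ) * phase (t * ∑ i, X i ω) ∂P -
      Complex.I * t * ∫ ω, phase (t * ∑ i, X i ω) ∂P‖ ≤
      9 * |t| ^ (1 + θ) * (2 * d) ^ (1 + θ) * ∑ k, absMoment P X θ k := by
  have hX := h.measurable
  have hm : 0 < 2 * d := by positivity
  set φ := ∫ ω, phase (t * ∑ i, X i ω) ∂P with hφ
  set a := absMoment P X θ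
  have ha : ∀ k, 0 ≤ a k := absMoment_nonneg
  have hvar' : ∑ k, ∑ j ∈ nb k, ∫ ω, X k ω * X j ω ∂P = 1 := by
    rw [← hvar]
    have : ∀ ω, (∑ k, X k ω) ^ 2 = ∑ k, ∑ j, X k ω * X j ω := fun ω => by
      rw [sq, Finset.sum_mul_sum]
    simp_rw [this]
    rw [integral_finsetSum _ fun k _ => integrable_finsetSum _ fun j _ => h.integrable_mul h0 k j]
    refine Finset.sum_congr rfl fun k _ => ?_
    rw [integral_finsetSum _ fun j _ => h.integrable_mul h0 k j]
    refine Finset.sum_subset (Finset.subset_univ _) fun j _ hj => ?_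
    rw [(h.indepFun hj).integral_fun_mul_eq_mul_integral (hX k).aestronglyMeasurable
      (hX j).aestronglyMeasurable, h.integral_eq_zero k, zero_mul]
  have hvarC : ∑ k, ∑ j ∈ nb k, ((∫ ω, X k ω * X j ω ∂P : ℝ) : ℂ) = 1 := by
    exact_mod_cast congrArg (fun x : ℝ => (x : ℂ)) hvar'
  have hW : ∫ ω, ((∑ k, X k ω : ℝ) : ℂ) * phase (t * ∑ i, X i ω) ∂P =
      ∑ k, ∫ ω, (X k ω : ℂ) * phase (t * ∑ i, X i ω) ∂P := by
    rw [← integral_finsetSum _ fun k _ => integrable_mul_phase (h.integrable h0 k) (by fun_prop)]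
    congr 1
    funext ω
    rw [← Finset.sum_mul]
    push_cast
    rfl
  set E : V → V → ℂ := fun k j =>
    ∫ ω, ((X k ω * X j ω : ℝ) : ℂ) * phase (t * ∑ i ∈ (nb k)ᶜ, X i ω) ∂P with hE
  have hdec : ∫ ω, ((∑ k, X k ω : ℝ) : ℂ) * phase (t * ∑ i, X i ω) ∂P - Complex.I * t * φ =
      ∑ k, (∫ ω, (X k ω : ℂ) * phase (t * ∑ i, X i ω) ∂P -
        Complex.I * t * ∑ j ∈ nb k, E k j) +
      Complex.I * t * ∑ k, ∑ j ∈ nb k, (E k j - ((∫ ω, X k ω * X j ω ∂P : ℝ) : ℂ) * φ) := by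
    rw [hW]
    simp_rw [Finset.sum_sub_distrib, ← Finset.sum_mul, hvarC, ← Finset.mul_sum]
    ring
  have hfirst : ∑ k, (a k + (∑ j ∈ nb k, a j) / (2 * d)) ≤ 3 / 2 * ∑ k, a k := by
    rw [Finset.sum_add_distrib, ← Finset.sum_div, h.sum_sum_nb_comm]
    have := h.sum_sum_nb_le ha
    have : (∑ k, ∑ _j ∈ nb k, a k) / (2 * d) ≤ 1 / 2 * ∑ k, a k := by
      rw [div_le_iff₀ hm]
      linarith
    linarith
  have hsecond : ∑ k, ∑ j ∈ nb k, (a k + a j +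
      (∑ i ∈ nb k, a i + ∑ i ∈ nb j, a i) / (2 * d)) ≤ 3 * d * ∑ k, a k := by
    have e1 := h.sum_sum_nb_le ha
    have e2 := h.sum_sum_nb_comm a
    have e3 := h.sum_sum_nb_le (f := fun k => ∑ i ∈ nb k, a i)
      fun k => Finset.sum_nonneg fun i _ => ha i
    have e4 := h.sum_sum_nb_comm (fun k => ∑ i ∈ nb k, a i)
    have e5 : (∑ k, ∑ _j ∈ nb k, ∑ i ∈ nb k, a i + ∑ k, ∑ j ∈ nb k, ∑ i ∈ nb j, a i) / (2 * d) ≤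
        d * ∑ k, a k := by
      rw [div_le_iff₀ hm, e4]
      have : d * ∑ k, ∑ i ∈ nb k, a i ≤ d * (d * ∑ k, a k) := by
        gcongr
        exact e2.trans_le e1
      linarith
    simp only [Finset.sum_add_distrib, ← Finset.sum_div] at *
    linarith
  have hpow : ∀ x : ℝ, 0 ≤ x → x * x ^ θ = x ^ (1 + θ) := fun x hx => by
    rw [Real.rpow_add' hx (by linarith), Real.rpow_one]
  rw [hdec]
  calc _ ≤ ∑ k, 2 * |t| ^ (1 + θ) * (2 * d) ^ (1 + θ) * (a k + (∑ j ∈ nb k, a j) / (2 * d)) +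
        |t| * ∑ k, ∑ j ∈ nb k, 4 * |t| ^ θ * (2 * d) ^ θ * (a k + a j +
          (∑ i ∈ nb k, a i + ∑ i ∈ nb j, a i) / (2 * d)) := by
        refine (norm_add_le _ _).trans (add_le_add ?_ ?_)
        · refine norm_sum_le_of_le _ fun k _ => ?_
          exact h.norm_integral_mul_phase_sub_le h0 h1 hm (by linarith) t k
        · rw [norm_mul, norm_mul, Complex.norm_I, one_mul, Complex.norm_real, Real.norm_eq_abs]
          gcongr
          refine norm_sum_le_of_le _ fun k _ => norm_sum_le_of_le _ fun j _ => ?_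
          exact h.norm_integral_mul_mul_phase_sub_le h0 h1 hd t k j
    _ = 2 * |t| ^ (1 + θ) * (2 * d) ^ (1 + θ) * ∑ k, (a k + (∑ j ∈ nb k, a j) / (2 * d)) +
        4 * |t| ^ (1 + θ) * (2 * d) ^ θ * ∑ k, ∑ j ∈ nb k, (a k + a j +
          (∑ i ∈ nb k, a i + ∑ i ∈ nb j, a i) / (2 * d)) := by
        simp_rw [← Finset.mul_sum]
        rw [← hpow |t| (abs_nonneg t)]
        ring
    _ ≤ 2 * |t| ^ (1 + θ) * (2 * d) ^ (1 + θ) * (3 / 2 * ∑ k, a k) +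
        4 * |t| ^ (1 + θ) * (2 * d) ^ θ * (3 * d * ∑ k, a k) := by gcongr
    _ = _ := by
        rw [← hpow (2 * d) hm.le]
        ring

end IsLocallyDependent

/-! ### Comparison of characteristic functions -/

namespace IsLocallyDependent

variable {V Ω : Type*} [Fintype V] [DecidableEq V] [MeasurableSpace Ω]
  {P : Measure Ω} [IsProbabilityMeasure P] {X : V → Ω → ℝ} {nb : V → Finset V} {θ d : ℝ}

omit [Fintype V] [DecidableEq V] in
lemma hasDerivAt_integral_phase {W : Ω → ℝ} (hW : Measurable W) (hint : Integrable W P) (t : ℝ) :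
    HasDerivAt (fun s : ℝ => ∫ ω, phase (s * W ω) ∂P)
      (Complex.I * ∫ ω, (W ω : ℂ) * phase (t * W ω) ∂P) t := by
  rw [← integral_const_mul]
  refine (hasDerivAt_integral_of_dominated_loc_of_deriv_le (s := Set.univ)
    (F := fun (s : ℝ) ω => phase (s * W ω))
    (F' := fun s ω => Complex.I * ((W ω : ℂ) * phase (s * W ω))) (bound := fun ω => |W ω|)
    Filter.univ_mem (Eventually.of_forall fun s => ?_) ?_ ?_ ?_ hint.abs ?_).2
  · apply Measurable.aestronglyMeasurable
    fun_prop
  · exact Integrable.of_bound (C := 1)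
      (by apply Measurable.aestronglyMeasurable; fun_prop) (by simp)
  · apply Measurable.aestronglyMeasurable
    fun_prop
  · exact ae_of_all _ fun ω s _ => by simp
  · refine ae_of_all _ fun ω s _ => ?_
    have h1 : HasDerivAt (fun s : ℝ => Complex.I * ((s * W ω : ℝ) : ℂ)) (Complex.I * W ω) s := by
      have := (((hasDerivAt_id s).mul_const (W ω)).ofReal_comp).const_mul Complex.I
      simpa using this
    convert! h1.cexp using 1
    simp only [phase]
    ring

/-- Quantitative central limit theorem: the characteristic function of a normalized sum of locally
dependent variables is close to the Gaussian one. -/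
theorem norm_integral_phase_sub_exp_le (h : IsLocallyDependent P X nb θ d) (h0 : 0 < θ)
    (h1 : θ ≤ 1) (hd : 0 < d) (hvar : ∫ ω, (∑ k, X k ω) ^ 2 ∂P = 1) (t : ℝ) :
    ‖∫ ω, phase (t * ∑ i, X i ω) ∂P - Complex.exp (-t ^ 2 / 2)‖ ≤
      Real.exp (t ^ 2 / 2) * (9 * |t| ^ (1 + θ) * (2 * d) ^ (1 + θ) *
        ∑ k, absMoment P X θ k) * |t| := by
  have hX := h.measurable
  have hint : Integrable (fun ω => ∑ k, X k ω) P :=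
    integrable_finsetSum _ fun k _ => h.integrable h0 k
  set φ : ℝ → ℂ := fun s => ∫ ω, phase (s * ∑ i, X i ω) ∂P with hφ
  set ψ : ℝ → ℂ := fun s => ∫ ω, ((∑ k, X k ω : ℝ) : ℂ) * phase (s * ∑ i, X i ω) ∂P with hψ
  have hφ' : ∀ s, HasDerivAt φ (Complex.I * ψ s) s := fun s =>
    hasDerivAt_integral_phase (W := fun ω => ∑ k, X k ω) (by fun_prop) hint s
  have hE : ∀ s : ℝ, HasDerivAt (fun s : ℝ => Complex.exp ((s ^ 2 / 2 : ℝ) : ℂ))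
      (Complex.exp ((s ^ 2 / 2 : ℝ) : ℂ) * s) s := by
    intro s
    have := (((hasDerivAt_pow 2 s).div_const 2).ofReal_comp).cexp
    convert! this using 1
    push_cast
    ring
  -- multiplication by the integrating factor `exp (s² / 2)` turns the approximate equation for
  -- `φ` into a bound on a derivative
  have hprod : ∀ s, HasDerivAt (fun s : ℝ => Complex.exp ((s ^ 2 / 2 : ℝ) : ℂ) * φ s)
      (Complex.I * Complex.exp ((s ^ 2 / 2 : ℝ) : ℂ) * (ψ s - Complex.I * s * φ s)) s := by
    intro s
    convert! (hE s).mul (hφ' s) using 1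
    linear_combination (-Complex.exp ((s ^ 2 / 2 : ℝ) : ℂ) * s * φ s) * Complex.I_sq
  have hA : 0 ≤ ∑ k, absMoment P X θ k := Finset.sum_nonneg fun k _ => absMoment_nonneg k
  have hmv := (convex_uIcc (0 : ℝ) t).norm_image_sub_le_of_norm_hasDerivWithin_le
    (f := fun s : ℝ => Complex.exp ((s ^ 2 / 2 : ℝ) : ℂ) * φ s) (x := 0) (y := t)
    (C := Real.exp (t ^ 2 / 2) * (9 * |t| ^ (1 + θ) * (2 * d) ^ (1 + θ) *
        ∑ k, absMoment P X θ k))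
    (fun s _ => (hprod s).hasDerivWithinAt) (fun s hs => by
      have hst : |s| ≤ |t| := by
        simpa using Set.abs_sub_left_of_mem_uIcc hs
      rw [norm_mul, norm_mul, Complex.norm_I, one_mul, Complex.norm_exp_ofReal]
      have hsq : s ^ 2 ≤ t ^ 2 := sq_le_sq.2 hst
      gcongr
      refine (h.norm_integral_sum_mul_phase_sub_le h0 h1 hd hvar s).trans ?_
      gcongr) Set.left_mem_uIcc Set.right_mem_uIcc
  have hone : φ 0 = 1 := by simp [hφ]
  have hfac : φ t - Complex.exp (-t ^ 2 / 2) = Complex.exp ((-t ^ 2 / 2 : ℝ) : ℂ) *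
      (Complex.exp ((t ^ 2 / 2 : ℝ) : ℂ) * φ t -
        Complex.exp (((0 : ℝ) ^ 2 / 2 : ℝ) : ℂ) * φ 0) := by
    rw [mul_sub, ← mul_assoc, ← Complex.exp_add, hone]
    push_cast
    rw [show (-(t : ℂ) ^ 2 / 2 + (t : ℂ) ^ 2 / 2) = 0 by ring]
    simp
  rw [hfac, norm_mul, Complex.norm_exp_ofReal]
  refine (mul_le_of_le_one_left (norm_nonneg _) ?_).trans ?_
  · rw [Real.exp_le_one_iff]
    nlinarith [sq_nonneg t]
  · simpa using hmv

end IsLocallyDependent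

/-! ### Dependency graphs -/

namespace Multigraph

variable {V : Type*} [Fintype V]

open Classical in
/-- The closed neighbourhood of a vertex: the vertex itself and all vertices joined to it. -/
noncomputable def closedNbhd (G : Multigraph V) (k : V) : Finset V :=
  {j | j = k ∨ s(k, j) ∈ G.edges}

lemma mem_closedNbhd {G : Multigraph V} {j k : V} :
    j ∈ G.closedNbhd k ↔ j = k ∨ s(k, j) ∈ G.edges := by
  simp [closedNbhd]

lemma card_closedNbhd_le (G : Multigraph V) (k : V) :
    (G.closedNbhd k).card ≤ G.maxDegree + 1 := by
  classical
  have h1 : (G.closedNbhd k).card - 1 ≤ ((G.closedNbhd k).erase k).card :=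
    Finset.pred_card_le_card_erase
  have h2 : ((G.closedNbhd k).erase k).card ≤ G.degree k := by
    calc ((G.closedNbhd k).erase k).card
        ≤ (G.edges.filter (fun e => k ∈ e)).toFinset.card := by
          refine Finset.card_le_card_of_injOn (fun j => s(k, j)) (fun j hj => ?_) fun i _ j _ hij => ?_
          · have hj' : j ≠ k ∧ (j = k ∨ s(k, j) ∈ G.edges) := by
              simpa [mem_closedNbhd, and_comm] using hj
            simpa using hj'.2.resolve_left hj'.1
          · exact Sym2.congr_right.1 hij
      _ ≤ G.degree k := by
          refine (Multiset.toFinset_card_le _).trans (le_of_eq ?_)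
          unfold degree
          congr!
  have h3 : G.degree k ≤ G.maxDegree := Finset.le_sup (f := G.degree) (Finset.mem_univ k)
  omega

variable {Ω : Type*} [DecidableEq V] [MeasurableSpace Ω] {P : Measure Ω} [IsProbabilityMeasure P]

/-- Centring and rescaling a family with a dependency graph gives a locally dependent family. -/
lemma IsDependencyGraph.isLocallyDependent {G : Multigraph V} {Y : V → Ω → ℝ}
    (hG : G.IsDependencyGraph Y P) (hY : ∀ k, Measurable (Y k)) {θ : ℝ} (hθ : 0 < θ)
    (hL : ∀ k, MemLp (Y k) (ENNReal.ofReal (2 + θ)) P) (v : ℝ) :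
    IsLocallyDependent P (fun k ω => (Y k ω - ∫ ω', Y k ω' ∂P) / v) G.closedNbhd θ
      ((G.maxDegree : ℝ) + 1) where
  measurable k := by have := hY k; fun_prop
  memLp k := by
    simp_rw [div_eq_mul_inv]
    exact ((hL k).sub (memLp_const _)).mul_const _
  integral_eq_zero k := by
    have hi : Integrable (Y k) P := (hL k).integrable (by
      rw [← ENNReal.ofReal_one]; exact ENNReal.ofReal_le_ofReal (by linarith))
    rw [integral_div, integral_sub hi (integrable_const _)]
    simp
  self_mem k := mem_closedNbhd.2 (Or.inl rfl)
  symm {j k} hj := by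
    rw [mem_closedNbhd] at hj ⊢
    rw [Sym2.eq_swap]
    exact hj.imp Eq.symm id
  card_le k := by exact_mod_cast G.card_closedNbhd_le k
  indep T := by
    have h := hG (T : Set V) (((T.biUnion G.closedNbhd)ᶜ : Finset V) : Set V) ?_ ?_
    · exact h.comp (φ := fun (x : ↥(T : Set V) → ℝ) (k : (T : Set V)) => (x k - ∫ ω', Y k ω' ∂P) / v)
        (ψ := fun (x : ↥(((T.biUnion G.closedNbhd)ᶜ : Finset V) : Set V) → ℝ)
          (k : (((T.biUnion G.closedNbhd)ᶜ : Finset V) : Set V)) =>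
          (x k - ∫ ω', Y k ω' ∂P) / v) (by fun_prop) (by fun_prop)
    · rw [Finset.disjoint_coe, Finset.disjoint_left]
      intro a ha hb
      rw [Finset.mem_compl, Finset.mem_biUnion] at hb
      exact hb ⟨a, ha, mem_closedNbhd.2 (Or.inl rfl)⟩
    · intro a ha b hb hab
      rw [Finset.mem_coe, Finset.mem_compl, Finset.mem_biUnion] at hb
      exact hb ⟨a, ha, mem_closedNbhd.2 (Or.inr hab)⟩

end Multigraph

/-! ### Moments of a single variable -/

section Moments

variable {Ω : Type*} [MeasurableSpace Ω] {P : Measure Ω} [IsProbabilityMeasure P]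

lemma MeasureTheory.MemLp.integrable_abs_sub_rpow {Y : Ω → ℝ} {p : ℝ} (hp : 0 < p)
    (hY : MemLp Y (ENNReal.ofReal p) P) (c : ℝ) : Integrable (fun ω => |Y ω - c| ^ p) P := by
  have := (hY.sub (memLp_const c)).integrable_norm_rpow (by simpa using hp) (by simp)
  rwa [ENNReal.toReal_ofReal hp.le] at this

/-- Jensen's inequality for powers. -/
lemma integral_rpow_le_integral_rpow {f : Ω → ℝ} {p : ℝ} (hp : 1 ≤ p) (hf : ∀ ω, 0 ≤ f ω)
    (hfi : Integrable f P) (hfp : Integrable (fun ω => f ω ^ p) P) :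
    (∫ ω, f ω ∂P) ^ p ≤ ∫ ω, f ω ^ p ∂P :=
  (convexOn_rpow hp).map_integral_le
    (Real.continuous_rpow_const (by linarith)).continuousOn isClosed_Ici
    (ae_of_all _ hf) hfi hfp

/-- Centring at the expectation is, up to a constant, at least as good as any other centring. -/
lemma integral_abs_sub_integral_rpow_le {Y : Ω → ℝ} {p : ℝ} (hp : 1 ≤ p)
    (hY : MemLp Y (ENNReal.ofReal p) P) (c : ℝ) :
    ∫ ω, |Y ω - ∫ ω', Y ω' ∂P| ^ p ∂P ≤ 2 ^ p * ∫ ω, |Y ω - c| ^ p ∂P := by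
  have hp0 : 0 < p := by linarith
  have hi : Integrable Y P := hY.integrable (by
    rw [← ENNReal.ofReal_one]; exact ENNReal.ofReal_le_ofReal hp)
  set e := ∫ ω', Y ω' ∂P with he
  have hec : |c - e| ^ p ≤ ∫ ω, |Y ω - c| ^ p ∂P := by
    refine le_trans ?_ (integral_rpow_le_integral_rpow hp (fun ω => abs_nonneg _)
      (hi.sub (integrable_const c)).abs (hY.integrable_abs_sub_rpow hp0 c))
    gcongr
    refine le_trans (le_of_eq ?_) abs_integral_le_integral_abs
    rw [abs_sub_comm, integral_sub hi (integrable_const c)]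
    simp [he]
  have hpt : ∀ ω, |Y ω - e| ^ p ≤ 2 ^ (p - 1) * (|Y ω - c| ^ p + |c - e| ^ p) := by
    intro ω
    calc |Y ω - e| ^ p ≤ (|Y ω - c| + |c - e|) ^ p := by
          gcongr
          exact abs_sub_le _ _ _
      _ ≤ _ := by
          have := Real.rpow_sum_le_const_mul_sum_rpow (Finset.univ : Finset (Fin 2))
            ![Y ω - c, c - e] hp
          simpa [Fin.sum_univ_two] using this
  calc ∫ ω, |Y ω - e| ^ p ∂P ≤ ∫ ω, 2 ^ (p - 1) * (|Y ω - c| ^ p + |c - e| ^ p) ∂P :=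
        integral_mono (hY.integrable_abs_sub_rpow hp0 e)
          (((hY.integrable_abs_sub_rpow hp0 c).add (integrable_const _)).const_mul _) hpt
    _ = 2 ^ (p - 1) * (∫ ω, |Y ω - c| ^ p ∂P + |c - e| ^ p) := by
        rw [integral_const_mul, integral_add (hY.integrable_abs_sub_rpow hp0 c)
          (integrable_const _)]
        simp
    _ ≤ 2 ^ (p - 1) * (∫ ω, |Y ω - c| ^ p ∂P + ∫ ω, |Y ω - c| ^ p ∂P) := by gcongr
    _ = _ := by
        rw [Real.rpow_sub_one two_ne_zero]
        ring

end Moments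

/-! ### A single row -/

section Row

variable {V Ω : Type*} [Fintype V] [MeasurableSpace Ω] {P : Measure Ω}

lemma rowSD_sq (Y : V → Ω → ℝ) : rowSD Y P ^ 2 = variance (rowSum Y) P :=
  Real.sq_sqrt (variance_nonneg _ _)

lemma momentSum_nonneg (Y : V → Ω → ℝ) (c : V → ℝ) (δ : ℝ) : 0 ≤ momentSum Y P c δ :=
  Finset.sum_nonneg fun _ _ => integral_nonneg fun _ => by positivity

lemma measurable_rowSum {Y : V → Ω → ℝ} (hY : ∀ k, Measurable (Y k)) : Measurable (rowSum Y) := by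
  unfold rowSum
  fun_prop

lemma measurable_normalizedSum {Y : V → Ω → ℝ} (hY : ∀ k, Measurable (Y k)) :
    Measurable (normalizedSum Y P) := by
  have := measurable_rowSum hY
  unfold normalizedSum
  fun_prop

variable [IsProbabilityMeasure P]

omit [IsProbabilityMeasure P] in
lemma normalizedSum_eq_sum {Y : V → Ω → ℝ} (hY : ∀ k, Integrable (Y k) P) (ω : Ω) :
    normalizedSum Y P ω = ∑ k, (Y k ω - ∫ ω', Y k ω' ∂P) / rowSD Y P := by
  unfold normalizedSum rowSum
  rw [integral_finsetSum _ fun k _ => hY k, ← Finset.sum_div, Finset.sum_sub_distrib]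

/-- The characteristic function of a normalized row differs from the Gaussian one by a multiple of
the Lyapunov ratio `(D + 1)^(1 + θ) * A_{2 + θ} / v^(2 + θ)`, locally uniformly. -/
lemma norm_integral_phase_normalizedSum_sub_le [DecidableEq V] {G : Multigraph V} {Y : V → Ω → ℝ}
    (hG : G.IsDependencyGraph Y P) (hY : ∀ k, Measurable (Y k)) {θ : ℝ} (h0 : 0 < θ) (h1 : θ ≤ 1)
    (hL : ∀ k, MemLp (Y k) (ENNReal.ofReal (2 + θ)) P) (c : V → ℝ) (hv : 0 < rowSD Y P) (t : ℝ) :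
    ‖∫ ω, phase (t * normalizedSum Y P ω) ∂P - Complex.exp (-t ^ 2 / 2)‖ ≤
      Real.exp (t ^ 2 / 2) * (9 * |t| ^ (1 + θ) * 2 ^ (1 + θ) * 2 ^ (2 + θ)) * |t| *
        (((G.maxDegree : ℝ) + 1) ^ (1 + θ) * momentSum Y P c (2 + θ) / rowSD Y P ^ (2 + θ)) := by
  set v := rowSD Y P with hvdef
  have hld := hG.isLocallyDependent hY h0 hL v
  have hint : ∀ k, Integrable (Y k) P := fun k => (hL k).integrable (by
    rw [← ENNReal.ofReal_one]; exact ENNReal.ofReal_le_ofReal (by linarith))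
  have hd : (0 : ℝ) < (G.maxDegree : ℝ) + 1 := by positivity
  have hvar : ∫ ω, (∑ k, (Y k ω - ∫ ω', Y k ω' ∂P) / v) ^ 2 ∂P = 1 := by
    simp_rw [hvdef, ← normalizedSum_eq_sum hint]
    unfold normalizedSum
    simp_rw [div_pow]
    rw [integral_div, ← variance_eq_integral (measurable_rowSum hY).aemeasurable, rowSD_sq,
      div_self]
    rw [← rowSD_sq]
    positivity
  have hmain := hld.norm_integral_phase_sub_exp_le h0 h1 hd hvar t
  have hA : ∑ k, IsLocallyDependent.absMoment P
      (fun k ω => (Y k ω - ∫ ω', Y k ω' ∂P) / v) θ k ≤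
      2 ^ (2 + θ) * momentSum Y P c (2 + θ) / v ^ (2 + θ) := by
    unfold momentSum IsLocallyDependent.absMoment
    rw [Finset.mul_sum, Finset.sum_div]
    refine Finset.sum_le_sum fun k _ => ?_
    simp_rw [abs_div, abs_of_pos hv]
    simp_rw [Real.div_rpow (abs_nonneg _) hv.le]
    rw [integral_div]
    gcongr
    exact integral_abs_sub_integral_rpow_le (by linarith) (hL k) (c k)
  simp_rw [hvdef, normalizedSum_eq_sum hint]
  refine hmain.trans ?_
  calc _ ≤ Real.exp (t ^ 2 / 2) * (9 * |t| ^ (1 + θ) * (2 * ((G.maxDegree : ℝ) + 1)) ^ (1 + θ) *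
        (2 ^ (2 + θ) * momentSum Y P c (2 + θ) / v ^ (2 + θ))) * |t| := by gcongr
    _ = _ := by
      rw [Real.mul_rpow zero_le_two hd.le]
      ring

/-- The power mean inequality between absolute moments of order `3` and `δ ≥ 3`. -/
lemma momentSum_three_le {Y : V → Ω → ℝ} {δ : ℝ} (hδ : 3 ≤ δ)
    (hL : ∀ k, MemLp (Y k) (ENNReal.ofReal δ) P) (c : V → ℝ) (hV : 0 < Fintype.card V) :
    momentSum Y P c 3 ≤
      Fintype.card V * (momentSum Y P c δ / Fintype.card V) ^ (3 / δ) := by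
  set n : ℝ := (Fintype.card V : ℝ) with hn
  have hn0 : 0 < n := by rw [hn]; exact_mod_cast hV
  have hp : 1 ≤ δ / 3 := by rw [le_div_iff₀ (by norm_num)]; linarith
  have hL3 : ∀ k, MemLp (Y k) (ENNReal.ofReal 3) P := fun k =>
    (hL k).mono_exponent (ENNReal.ofReal_le_ofReal hδ)
  have hz : ∀ k, 0 ≤ ∫ ω, |Y k ω - c k| ^ (3 : ℝ) ∂P := fun k =>
    integral_nonneg fun ω => by positivity
  have hpow : ∀ k ω, (|Y k ω - c k| ^ (3 : ℝ)) ^ (δ / 3) = |Y k ω - c k| ^ δ := fun k ω => by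
    rw [← Real.rpow_mul (abs_nonneg _)]
    congr 1
    field_simp
  have hJ : ∀ k, (∫ ω, |Y k ω - c k| ^ (3 : ℝ) ∂P) ^ (δ / 3) ≤ ∫ ω, |Y k ω - c k| ^ δ ∂P := by
    intro k
    have := integral_rpow_le_integral_rpow (P := P) (f := fun ω => |Y k ω - c k| ^ (3 : ℝ)) hp
      (fun ω => by positivity) ((hL3 k).integrable_abs_sub_rpow (by norm_num) _)
      (by simp_rw [hpow]; exact (hL k).integrable_abs_sub_rpow (by linarith) _)
    simpa only [hpow] using this
  have h3 : (momentSum Y P c 3 / n) ^ (δ / 3) ≤ momentSum Y P c δ / n := by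
    have h := abs_sum_div_rpow_le (Finset.univ : Finset V)
      (fun k => ∫ ω, |Y k ω - c k| ^ (3 : ℝ) ∂P) hn0 (by simp [hn]) hp
    rw [abs_of_nonneg (Finset.sum_nonneg fun k _ => hz k)] at h
    refine h.trans ?_
    unfold momentSum
    gcongr with k
    rw [abs_of_nonneg (hz k)]
    exact hJ k
  have h4 : momentSum Y P c 3 / n ≤ (momentSum Y P c δ / n) ^ (3 / δ) := by
    have h0 : 0 ≤ momentSum Y P c 3 / n := div_nonneg (momentSum_nonneg _ _ _) hn0.le
    calc momentSum Y P c 3 / n = ((momentSum Y P c 3 / n) ^ (δ / 3)) ^ (3 / δ) := by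
          rw [← Real.rpow_mul h0]
          rw [show δ / 3 * (3 / δ) = 1 by field_simp, Real.rpow_one]
      _ ≤ _ := by gcongr
  rwa [div_le_iff₀ hn0, mul_comm] at h4

omit [IsProbabilityMeasure P] in
/-- The first renormalized condition in terms of moments, degree and standard deviation. -/
lemma xi_inv_mul_eq {Y : V → Ω → ℝ} {c : V → ℝ} {D : ℕ} {δ : ℝ} (hδ : 0 < δ)
    (hV : 0 < Fintype.card V) (hv : 0 < rowSD Y P) :
    (xi Y P c D δ)⁻¹ * (((D : ℝ) + 1) / Fintype.card V) ^ (1 / 2 - 1 / δ) =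
      momentSum Y P c δ ^ (1 / δ) * ((D : ℝ) + 1) ^ (1 - 1 / δ) / rowSD Y P := by
  unfold xi
  rw [← rowSD_sq]
  have hn : (0 : ℝ) < Fintype.card V := by exact_mod_cast hV
  have hd : (0 : ℝ) < (D : ℝ) + 1 := by positivity
  generalize rowSD Y P = v at *
  generalize (Fintype.card V : ℝ) = n at *
  generalize (D : ℝ) + 1 = d at *
  rcases (momentSum_nonneg Y c δ (P := P)).eq_or_lt with hA | hA
  · -- both sides are zero when all variables equal their centring constants
    rw [← hA, div_zero, Real.zero_rpow (one_div_pos.2 hδ).ne']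
    simp
  · generalize momentSum Y P c δ = A at *
    refine Real.log_injOn_pos (Set.mem_Ioi.2 (by positivity)) (Set.mem_Ioi.2 (by positivity)) ?_
    rw [Real.log_mul (by positivity) (by positivity), Real.log_inv,
      Real.log_mul (by positivity) (by positivity), Real.log_sqrt (by positivity),
      Real.log_div (by positivity) (by positivity), Real.log_div (by positivity) (by positivity),
      Real.log_rpow (by positivity), Real.log_rpow (by positivity),
      Real.log_div (by positivity) (by positivity), Real.log_pow,
      Real.log_mul (by positivity) (by positivity), Real.log_div (by positivity) (by positivity),
      Real.log_mul (by positivity) (by positivity), Real.log_rpow (by positivity),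
      Real.log_rpow (by positivity)]
    push_cast
    ring

omit [IsProbabilityMeasure P] in
/-- The second renormalized condition in terms of moments, degree and standard deviation. -/
lemma xi_pow_inv_mul_eq {Y : V → Ω → ℝ} {c : V → ℝ} {D : ℕ} {δ : ℝ} (hδ : 0 < δ)
    (hV : 0 < Fintype.card V) (hv : 0 < rowSD Y P) :
    (xi Y P c D δ ^ 3)⁻¹ * Real.sqrt (((D : ℝ) + 1) / Fintype.card V) =
      ((D : ℝ) + 1) ^ 2 * (Fintype.card V * (momentSum Y P c δ / Fintype.card V) ^ (3 / δ)) /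
        rowSD Y P ^ 3 := by
  unfold xi
  rw [← rowSD_sq]
  have hn : (0 : ℝ) < Fintype.card V := by exact_mod_cast hV
  have hd : (0 : ℝ) < (D : ℝ) + 1 := by positivity
  generalize rowSD Y P = v at *
  generalize (Fintype.card V : ℝ) = n at *
  generalize (D : ℝ) + 1 = d at *
  rcases (momentSum_nonneg Y c δ (P := P)).eq_or_lt with hA | hA
  · -- both sides are zero when all variables equal their centring constants
    rw [← hA, div_zero, zero_div, Real.zero_rpow (one_div_pos.2 hδ).ne',
      Real.zero_rpow (div_pos three_pos hδ).ne']
    simp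
  · generalize momentSum Y P c δ = A at *
    refine Real.log_injOn_pos (Set.mem_Ioi.2 (by positivity)) (Set.mem_Ioi.2 (by positivity)) ?_
    rw [Real.log_mul (by positivity) (by positivity), Real.log_inv, Real.log_pow,
      Real.log_mul (by positivity) (by positivity), Real.log_sqrt (by positivity),
      Real.log_sqrt (by positivity), Real.log_div (by positivity) (by positivity),
      Real.log_div (by positivity) (by positivity), Real.log_mul (by positivity) (by positivity),
      Real.log_div (by positivity) (by positivity), Real.log_mul (by positivity) (by positivity),
      Real.log_mul (by positivity) (by positivity), Real.log_rpow (by positivity),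
      Real.log_rpow (by positivity), Real.log_div (by positivity) (by positivity),
      Real.log_div (by positivity) (by positivity), Real.log_pow, Real.log_pow, Real.log_pow]
    push_cast
    ring

/-- Chebyshev's inequality for the sum divided by its variance. -/
lemma measure_le_abs_sub_div_variance_le {Y : V → Ω → ℝ} (hY : MemLp (rowSum Y) 2 P)
    (hv : 0 < rowSD Y P) {ε : ℝ} (hε : 0 < ε) :
    P {ω | ε ≤ |(rowSum Y ω - ∫ ω', rowSum Y ω' ∂P) / variance (rowSum Y) P|} ≤
      ENNReal.ofReal ((rowSD Y P)⁻¹ ^ 2 / ε ^ 2) := by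
  have hvar : 0 < variance (rowSum Y) P := by rw [← rowSD_sq]; positivity
  have h := meas_ge_le_variance_div_sq hY (mul_pos hε hvar)
  convert! h using 2
  · ext ω
    rw [Set.mem_ofPred_eq, Set.mem_ofPred_eq, abs_div, abs_of_pos hvar, le_div_iff₀ hvar]
  · rw [← rowSD_sq]
    field_simp

end Row

/-! ### Triangular arrays -/

section Array

variable {Ω : ℕ → Type*} [∀ N, MeasurableSpace (Ω N)] {P : ∀ N, Measure (Ω N)}
  [∀ N, IsProbabilityMeasure (P N)] {Y : ∀ N, Fin N → Ω N → ℝ} {G : ∀ N, Multigraph (Fin N)}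
  {D : ℕ → ℕ} {c : ∀ N, Fin N → ℝ}

/-- The central limit theorem for dependency graphs under a Lyapunov condition. -/
theorem tendstoInDistribution_normalizedSum_of_lyapunov (hY : ∀ N k, Measurable (Y N k))
    (hG : ∀ N, (G N).IsDependencyGraph (Y N) (P N)) (hD : ∀ N, (G N).maxDegree = D N)
    (hv : ∀ᶠ N in atTop, 0 < rowSD (Y N) (P N)) {θ : ℝ} (h0 : 0 < θ) (h1 : θ ≤ 1)
    (hL : ∀ N k, MemLp (Y N k) (ENNReal.ofReal (2 + θ)) (P N))
    (hlim : Tendsto (fun N => ((D N : ℝ) + 1) ^ (1 + θ) * momentSum (Y N) (P N) (c N) (2 + θ) /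
      rowSD (Y N) (P N) ^ (2 + θ)) atTop (𝓝 0)) :
    TendstoInDistribution (fun N => normalizedSum (Y N) (P N)) atTop
      (id : ℝ → ℝ) P (gaussianReal 0 1) where
  forall_aemeasurable N := (measurable_normalizedSum (hY N)).aemeasurable
  aemeasurable_limit := aemeasurable_id
  tendsto := by
    refine ProbabilityMeasure.tendsto_iff_tendsto_charFun.2 fun t => ?_
    have hN : ∀ N, charFun ((P N).map (normalizedSum (Y N) (P N))) t =
        ∫ ω, phase (t * normalizedSum (Y N) (P N) ω) ∂(P N) := by
      intro N
      rw [charFun_apply_real, integral_map (measurable_normalizedSum (hY N)).aemeasurable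
        (by apply Measurable.aestronglyMeasurable; fun_prop)]
      congr 1
      funext ω
      unfold phase
      push_cast
      ring_nf
    have hlimit : charFun ((gaussianReal 0 1).map (id : ℝ → ℝ)) t = Complex.exp (-t ^ 2 / 2) := by
      rw [Measure.map_id, charFun_gaussianReal]
      simp [neg_div]
    simp only [ProbabilityMeasure.coe_mk, hN, hlimit]
    rw [tendsto_iff_norm_sub_tendsto_zero]
    have hK := hlim.const_mul
      (Real.exp (t ^ 2 / 2) * (9 * |t| ^ (1 + θ) * 2 ^ (1 + θ) * 2 ^ (2 + θ)) * |t|)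
    rw [mul_zero] at hK
    refine squeeze_zero' (Eventually.of_forall fun _ => norm_nonneg _) ?_ hK
    filter_upwards [hv] with N hvN
    simpa [hD N] using
      norm_integral_phase_normalizedSum_sub_le (hG N) (hY N) h0 h1 (hL N) (c N) hvN t

/-- The weak law of large numbers holds as soon as the standard deviations tend to infinity. -/
theorem tendsto_measure_of_tendsto_rowSD_inv (hL : ∀ N k, MemLp (Y N k) 2 (P N))
    (hv : ∀ᶠ N in atTop, 0 < rowSD (Y N) (P N))
    (hlim : Tendsto (fun N => (rowSD (Y N) (P N))⁻¹) atTop (𝓝 0)) {ε : ℝ} (hε : 0 < ε) :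
    Tendsto (fun N => P N {ω | ε ≤
      |(rowSum (Y N) ω - ∫ ω', rowSum (Y N) ω' ∂(P N)) / variance (rowSum (Y N)) (P N)|})
      atTop (𝓝 0) := by
  have h : Tendsto (fun N => ENNReal.ofReal ((rowSD (Y N) (P N))⁻¹ ^ 2 / ε ^ 2)) atTop (𝓝 0) := by
    have := ENNReal.tendsto_ofReal ((hlim.pow 2).div_const (ε ^ 2))
    simpa using this
  refine tendsto_of_tendsto_of_tendsto_of_le_of_le' tendsto_const_nhds h
    (Eventually.of_forall fun _ => zero_le) ?_
  filter_upwards [hv] with N hvN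
  exact measure_le_abs_sub_div_variance_le (memLp_finsetSum _ fun k _ => hL N k) hvN hε

omit [∀ N, IsProbabilityMeasure (P N)] in
/-- A row with positive standard deviation is not empty. -/
lemma pos_of_rowSD_pos {N : ℕ} (h : 0 < rowSD (Y N) (P N)) : 0 < N := by
  rcases Nat.eq_zero_or_pos N with rfl | hN
  · have : rowSum (Y 0) = 0 := by
      funext ω
      simp [rowSum]
    simp [rowSD, this, variance_zero] at h
  · exact hN

omit [∀ N, IsProbabilityMeasure (P N)] in
/-- The first renormalized condition, with the normalization removed. -/
lemma tendsto_of_tendsto_xi (hv : ∀ᶠ N in atTop, 0 < rowSD (Y N) (P N)) {δ : ℝ} (hδ : 0 < δ)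
    (h : Tendsto (fun N : ℕ => (xi (Y N) (P N) (c N) (D N) δ)⁻¹ *
      (((D N : ℝ) + 1) / (N : ℝ)) ^ (1 / 2 - 1 / δ)) atTop (𝓝 0)) :
    Tendsto (fun N => momentSum (Y N) (P N) (c N) δ ^ (1 / δ) * ((D N : ℝ) + 1) ^ (1 - 1 / δ) /
      rowSD (Y N) (P N)) atTop (𝓝 0) := by
  refine h.congr' ?_
  filter_upwards [hv] with N hvN
  have := xi_inv_mul_eq (c := c N) (D := D N) hδ (by simpa using pos_of_rowSD_pos hvN) hvN
  rwa [Fintype.card_fin] at this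

lemma tendstoInDistribution_of_xiConditionLow (hY : ∀ N k, Measurable (Y N k))
    (hG : ∀ N, (G N).IsDependencyGraph (Y N) (P N)) (hD : ∀ N, (G N).maxDegree = D N)
    (hv : ∀ᶠ N in atTop, 0 < rowSD (Y N) (P N)) {δ : ℝ} (h : XiConditionLow P Y c D δ) :
    TendstoInDistribution (fun N => normalizedSum (Y N) (P N)) atTop
      (id : ℝ → ℝ) P (gaussianReal 0 1) := by
  obtain ⟨⟨h2, h3⟩, hL, hlim⟩ := h
  obtain ⟨θ, rfl⟩ : ∃ θ, δ = 2 + θ := ⟨δ - 2, by ring⟩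
  have hδ : 0 < 2 + θ := by linarith
  refine tendstoInDistribution_normalizedSum_of_lyapunov (c := c) hY hG hD hv (by linarith)
    (by linarith) hL ?_
  -- the Lyapunov ratio is the power `2 + θ` of the given null sequence
  have hpow := (tendsto_of_tendsto_xi hv hδ hlim).rpow_const (p := 2 + θ) (Or.inr hδ.le)
  rw [Real.zero_rpow hδ.ne'] at hpow
  refine hpow.congr' ?_
  filter_upwards [hv] with N hvN
  have hA := momentSum_nonneg (P := P N) (Y N) (c N) (2 + θ)
  have hd : (0 : ℝ) < (D N : ℝ) + 1 := by positivity
  rw [Real.div_rpow (by positivity) hvN.le, Real.mul_rpow (by positivity) (by positivity),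
    ← Real.rpow_mul hA, ← Real.rpow_mul hd.le, one_div_mul_cancel hδ.ne', Real.rpow_one,
    sub_mul, one_div_mul_cancel hδ.ne', mul_comm]
  congr 3
  ring

lemma tendstoInDistribution_of_xiConditionHigh (hY : ∀ N k, Measurable (Y N k))
    (hG : ∀ N, (G N).IsDependencyGraph (Y N) (P N)) (hD : ∀ N, (G N).maxDegree = D N)
    (hv : ∀ᶠ N in atTop, 0 < rowSD (Y N) (P N)) {δ : ℝ} (h : XiConditionHigh P Y c D δ) :
    TendstoInDistribution (fun N => normalizedSum (Y N) (P N)) atTop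
      (id : ℝ → ℝ) P (gaussianReal 0 1) := by
  obtain ⟨h3, hL, -, hlim⟩ := h
  refine tendstoInDistribution_normalizedSum_of_lyapunov (c := c) hY hG hD hv one_pos le_rfl
    (fun N k => (hL N k).mono_exponent (ENNReal.ofReal_le_ofReal (by linarith))) ?_
  refine squeeze_zero' (Eventually.of_forall fun N => ?_) ?_ hlim
  · have := momentSum_nonneg (P := P N) (Y N) (c N) (2 + 1)
    have : 0 ≤ rowSD (Y N) (P N) := Real.sqrt_nonneg _
    positivity
  filter_upwards [hv] with N hvN
  have hN : 0 < Fintype.card (Fin N) := by simpa using pos_of_rowSD_pos hvN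
  have e := xi_pow_inv_mul_eq (c := c N) (D := D N) (by linarith : 0 < δ) hN hvN
  have hm := momentSum_three_le h3 (hL N) (c N) hN
  rw [Fintype.card_fin] at e hm
  rw [e, show (2 : ℝ) + 1 = ((3 : ℕ) : ℝ) by norm_num, show (1 : ℝ) + 1 = ((2 : ℕ) : ℝ) by norm_num,
    Real.rpow_natCast, Real.rpow_natCast]
  push_cast
  gcongr

omit [∀ N, IsProbabilityMeasure (P N)] in
lemma BoundedCondition.exists_bound (h : BoundedCondition P Y c D) :
    ∃ M : ℝ, 0 ≤ M ∧ ∀ N k, ∀ᵐ ω ∂(P N), |Y N k ω - c N k| ≤ M := by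
  obtain ⟨hb, -, -⟩ := h
  refine ⟨_, ENNReal.toReal_nonneg (a := ⨆ N, ⨆ k : Fin N,
    eLpNorm (fun ω => Y N k ω - c N k) ⊤ (P N)), fun N k => ?_⟩
  have hle : eLpNorm (fun ω => Y N k ω - c N k) ⊤ (P N) ≤
      ⨆ N, ⨆ k : Fin N, eLpNorm (fun ω => Y N k ω - c N k) ⊤ (P N) :=
    le_iSup_of_le N (le_iSup_of_le k le_rfl)
  filter_upwards [ae_le_eLpNormEssSup (f := fun ω => Y N k ω - c N k) (μ := P N)] with ω hω
  rw [← eLpNorm_exponent_top] at hω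
  have := ENNReal.toReal_mono hb.ne (hω.trans hle)
  simpa using this

lemma BoundedCondition.memLp (h : BoundedCondition P Y c D) (hY : ∀ N k, Measurable (Y N k))
    (p : ENNReal) (N : ℕ) (k : Fin N) : MemLp (Y N k) p (P N) := by
  obtain ⟨M, -, hM⟩ := h.exists_bound
  refine MemLp.of_bound (hY N k).aestronglyMeasurable (M + |c N k|) ?_
  filter_upwards [hM N k] with ω hω
  rw [Real.norm_eq_abs]
  calc |Y N k ω| = |(Y N k ω - c N k) + c N k| := by ring_nf
    _ ≤ _ := (abs_add_le _ _).trans (by gcongr)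

lemma tendstoInDistribution_of_boundedCondition (hY : ∀ N k, Measurable (Y N k))
    (hG : ∀ N, (G N).IsDependencyGraph (Y N) (P N)) (hD : ∀ N, (G N).maxDegree = D N)
    (hv : ∀ᶠ N in atTop, 0 < rowSD (Y N) (P N)) (h : BoundedCondition P Y c D) :
    TendstoInDistribution (fun N => normalizedSum (Y N) (P N)) atTop
      (id : ℝ → ℝ) P (gaussianReal 0 1) := by
  have hL := fun N k => h.memLp hY (ENNReal.ofReal (2 + 1)) N k
  refine tendstoInDistribution_normalizedSum_of_lyapunov (c := c) hY hG hD hv one_pos le_rfl hL ?_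
  obtain ⟨M, hM0, hM⟩ := h.exists_bound
  have hlim := h.2.2.const_mul (M ^ 3)
  rw [mul_zero] at hlim
  refine squeeze_zero (fun N => ?_) (fun N => ?_) hlim
  · have := momentSum_nonneg (P := P N) (Y N) (c N) (2 + 1)
    have : 0 ≤ rowSD (Y N) (P N) := Real.sqrt_nonneg _
    positivity
  have hv0 : 0 ≤ rowSD (Y N) (P N) := Real.sqrt_nonneg _
  have hm : momentSum (Y N) (P N) (c N) (2 + 1) ≤ N * M ^ 3 := by
    calc momentSum (Y N) (P N) (c N) (2 + 1) ≤ ∑ _k : Fin N, M ^ 3 := by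
          refine Finset.sum_le_sum fun k _ => ?_
          calc ∫ ω, |Y N k ω - c N k| ^ ((2 : ℝ) + 1) ∂(P N) ≤ ∫ _ω, M ^ 3 ∂(P N) := by
                refine integral_mono_ae ((hL N k).integrable_abs_sub_rpow (by norm_num) _)
                  (integrable_const _) ?_
                filter_upwards [hM N k] with ω hω
                rw [show (2 : ℝ) + 1 = ((3 : ℕ) : ℝ) by norm_num, Real.rpow_natCast]
                gcongr
            _ = M ^ 3 := by simp
      _ = N * M ^ 3 := by simp
  calc _ ≤ ((D N : ℝ) + 1) ^ ((1 : ℝ) + 1) * (N * M ^ 3) /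
        rowSD (Y N) (P N) ^ ((2 : ℝ) + 1) := by gcongr
    _ = _ := by
      rw [show (2 : ℝ) + 1 = ((3 : ℕ) : ℝ) by norm_num,
        show (1 : ℝ) + 1 = ((2 : ℕ) : ℝ) by norm_num, Real.rpow_natCast, Real.rpow_natCast]
      ring

omit [∀ N, IsProbabilityMeasure (P N)] in
lemma tendsto_rowSD_inv_of_boundedCondition (h : BoundedCondition P Y c D) :
    Tendsto (fun N => (rowSD (Y N) (P N))⁻¹) atTop (𝓝 0) := by
  refine squeeze_zero (fun N => inv_nonneg.2 (Real.sqrt_nonneg _)) (fun N => ?_) h.2.1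
  have : 0 ≤ rowSD (Y N) (P N) := Real.sqrt_nonneg _
  rw [inv_eq_one_div]
  gcongr
  simp

omit [∀ N, IsProbabilityMeasure (P N)] in
lemma tendsto_rowSD_inv_of_tendsto_xi (hv : ∀ᶠ N in atTop, 0 < rowSD (Y N) (P N)) {δ : ℝ}
    (hδ : 1 < δ) (hA : 0 < liminf (fun N => (momentSum (Y N) (P N) (c N) δ : EReal)) atTop)
    (h : Tendsto (fun N : ℕ => (xi (Y N) (P N) (c N) (D N) δ)⁻¹ *
      (((D N : ℝ) + 1) / (N : ℝ)) ^ (1 / 2 - 1 / δ)) atTop (𝓝 0)) :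
    Tendsto (fun N => (rowSD (Y N) (P N))⁻¹) atTop (𝓝 0) := by
  have hδ0 : 0 < δ := by linarith
  obtain ⟨a, ha, haA⟩ := EReal.lt_iff_exists_real_btwn.1 hA
  have ha0 : 0 < a := by exact_mod_cast ha
  have hlim := (tendsto_of_tendsto_xi hv hδ0 h).const_mul (a ^ (1 / δ))⁻¹
  rw [mul_zero] at hlim
  refine squeeze_zero' (Eventually.of_forall fun N => inv_nonneg.2 (Real.sqrt_nonneg _)) ?_ hlim
  filter_upwards [hv, eventually_lt_of_lt_liminf haA] with N hvN haN
  have haN' : a ≤ momentSum (Y N) (P N) (c N) δ := le_of_lt (by exact_mod_cast haN)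
  have hd : 1 ≤ ((D N : ℝ) + 1) ^ (1 - 1 / δ) := by
    refine Real.one_le_rpow (by simp) ?_
    rw [sub_nonneg, div_le_one hδ0]
    exact hδ.le
  calc (rowSD (Y N) (P N))⁻¹ = (a ^ (1 / δ))⁻¹ * (a ^ (1 / δ) * 1 / rowSD (Y N) (P N)) := by
        field_simp
    _ ≤ _ := by
        have := momentSum_nonneg (P := P N) (Y N) (c N) δ
        gcongr

end Array

theorem mainTheorem5 {Ω : ℕ → Type*} [∀ N, MeasurableSpace (Ω N)]
    (P : ∀ N, Measure (Ω N)) [∀ N, IsProbabilityMeasure (P N)]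
    (Y : ∀ N, Fin N → Ω N → ℝ) (hY : ∀ N k, Measurable (Y N k))
    (G : ∀ N, Multigraph (Fin N))
    (hG : ∀ N, (G N).IsDependencyGraph (Y N) (P N))
    (D : ℕ → ℕ) (hD : ∀ N, (G N).maxDegree = D N)
    (c : ∀ N, Fin N → ℝ)
    (hv : ∀ᶠ N in atTop, 0 < rowSD (Y N) (P N))
    (δ : ℝ) :
    ((XiConditionLow P Y c D δ ∨ XiConditionHigh P Y c D δ ∨ BoundedCondition P Y c D) →
      TendstoInDistribution (fun N => normalizedSum (Y N) (P N)) atTop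
        (id : ℝ → ℝ) P (gaussianReal 0 1)) ∧
    ((BoundedCondition P Y c D ∨
        (0 < liminf (fun N => (momentSum (Y N) (P N) (c N) δ : EReal)) atTop ∧
          (XiConditionLow P Y c D δ ∨ XiConditionHigh P Y c D δ))) →
      ∀ ε : ℝ, 0 < ε →
        Tendsto (fun N => P N {ω | ε ≤
          |(rowSum (Y N) ω - ∫ ω', rowSum (Y N) ω' ∂(P N)) / variance (rowSum (Y N)) (P N)|})
          atTop (𝓝 0)) := by
  refine ⟨?_, ?_⟩
  · rintro (h | h | h)
    · exact tendstoInDistribution_of_xiConditionLow hY hG hD hv h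
    · exact tendstoInDistribution_of_xiConditionHigh hY hG hD hv h
    · exact tendstoInDistribution_of_boundedCondition hY hG hD hv h
  · intro h ε hε
    have two_le : ∀ {p : ℝ}, 2 ≤ p → (2 : ENNReal) ≤ ENNReal.ofReal p := fun hp => by
      rw [← ENNReal.ofReal_ofNat]
      exact ENNReal.ofReal_le_ofReal hp
    rcases h with h | ⟨hA, h | h⟩
    · exact tendsto_measure_of_tendsto_rowSD_inv (h.memLp hY 2) hv
        (tendsto_rowSD_inv_of_boundedCondition h) hε
    · obtain ⟨⟨h2, -⟩, hL, hlim⟩ := h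
      exact tendsto_measure_of_tendsto_rowSD_inv
        (fun N k => (hL N k).mono_exponent (two_le h2.le)) hv
        (tendsto_rowSD_inv_of_tendsto_xi hv (by linarith) hA hlim) hε
    · obtain ⟨h3, hL, hlim, -⟩ := h
      exact tendsto_measure_of_tendsto_rowSD_inv
        (fun N k => (hL N k).mono_exponent (two_le (by linarith))) hv
        (tendsto_rowSD_inv_of_tendsto_xi hv (by linarith) hA hlim) hε
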